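/- Let $X=X_0\sqcup\dots\sqcup X_d$ ($d>0$) be a finite complex: the $X_k$ are nonempty finite (ordered) sets of $k$-cells, $C_k=\mathbb{Z}^{X_k}$, and the boundary maps $\partial_k:C_k\to C_{k-1}$ are integer matrices with $\partial_k\partial_{k+1}=0$ (for instance, the cellular chain complex of a cell complex). The complex is augmented by $C_{-1}=\mathbb{Z}$ and $\partial_0=(1,\dots,1)$, with $\partial_0\partial_1=0$; all other groups and maps are zero. Put $\delta_k=\partial_{k+1}^t$, $Z_k=\ker\partial_k$, $B_k=\operatorname{im}\partial_{k+1}$, $Z^k=\ker\delta_k$, $B^k=\operatorname{im}\delta_{k-1}$ (all over $\mathbb{Z}$), $\widetilde H_k(X)=Z_k/B_k$ and $\widetilde H^k(X)=Z^k/B^k$. Fix $i$ and assume $$\operatorname{rk}\widetilde H_{i+1}(X)=0,\qquad \operatorname{rk}\widetilde H_i(X)=1,\qquad \operatorname{rk}\widetilde H_{i-1}(X)=0 .$$ For an $n\times(n+1)$ matrix $A$ let $v_A$ be the vector with $j$-th entry $(-1)^j\det([A]_j)$, where $[A]_j$ is $A$ without its $j$-th column. For an integer matrix $M$ whose columns lie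 in a lattice with basis $Z$, let $[M]_Z$ be the matrix of coordinates of its columns with respect to $Z$, and let $M|_I$ be its submatrix of columns indexed by $I$. * A cycletree $U$ is given by a set $I(U)\subseteq X_i$ with $|I(U)|=\operatorname{rk}Z_{i-1}+1$. Its cycle part $C_U\in Z_i$ is $v_{A|_{I(U)}}$, $A=[\partial_i]_Z$ for a basis $Z$ of $Z_{i-1}$, extended by zero outside $I(U)$. The winding number of $z\in Z_i$ is $w(z)=\det([z]_Z,[\overline\partial_{i+1}]_Z)$, where now $Z$ is a basis of $Z_i$ and the columns of $\overline\partial_{i+1}$ form a $\mathbb{Z}$-basis of $B_i$. The standard harmonic cycle is $\lambda=\sum_U w(C_U)\,C_U\in Z_i$, summed over all cycletrees. * Dually, a dual cycletree $U^*$ is given by a set $I(U^*)\subseteq X_i$ with $|I(U^*)|=\operatorname{rk}Z^{i+1}+1$. Its cocycle part $C_{U^*}\in Z^i$ is $v_{A|_{I(U^*)}}$, $A=[\delta_i]_Z$ for a basis $Z$ of $Z^{i+1}$, extended by zero. The cutting number of $z\in Z^i$ is $c(z)=\det([z]_Z,[\overline\delta_{i-1}]_Z)$, where $Z$ is a basis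 of $Z^i$ and the columns of $\overline\delta_{i-1}$ form a $\mathbb{Z}$-basis of $B^i$. The standard harmonic cocycle is $\lambda^*=\sum_{U^*}c(C_{U^*})\,C_{U^*}\in Z^i$, summed over all dual cycletrees. Then the groups $\widetilde H_{i-1}(X)$ and $\widetilde H^{i+1}(X)$ are finite and, for every choice of the bases above, $$\frac{\lambda}{|\widetilde H_{i-1}(X)|}=\pm\,\frac{\lambda^*}{|\widetilde H^{i+1}(X)|}$$ as vectors in $C_i(X;\mathbb{Q})=\mathbb{Q}^{X_i}$, with one common sign for all coordinates. -/

import Mathlib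

open Matrix Module

universe u

/-- A complex `X = X₀ ⊔ ⋯ ⊔ X_d` of dimension `d > 0`: finite sets of cells `X_k`, nonempty for
`0 ≤ k ≤ d` and empty for `k > d`, each listed in some order (the order of the rows and columns of
the boundary matrices), together with integer boundary matrices `∂_{k+1} : C_{k+1} → C_k`
such that `∂_k ∂_{k+1} = 0`.  The last field says that `∂₀ ∂₁ = 0` for the augmentation `∂₀`. -/
structure CellComplex : Type (u + 1) where
  dim : ℕ
  dim_pos : 0 < dim
  cells : ℕ → Type u
  fintypeCells : ∀ k, Fintype (cells k)
  orderCells : ∀ k, LinearOrder (cells k)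
  nonempty_cells : ∀ k, k ≤ dim → Nonempty (cells k)
  isEmpty_cells : ∀ k, dim < k → IsEmpty (cells k)
  /-- `bd k` is the matrix of `∂_{k+1}`. -/
  bd : ∀ k, Matrix (cells k) (cells (k + 1)) ℤ
  bd_comp : ∀ k, bd k * bd (k + 1) = 0
  aug_comp : ∀ e : cells 1, ∑ v, bd 0 v e = 0

namespace CellComplex

attribute [instance] fintypeCells orderCells

/-- The generators of the augmented chain complex in degree `k : ℤ`: the `k`-cells for `k ≥ 0`,
one generator (the empty cell) for `k = -1`, none below. -/
def Cell (X : CellComplex.{u}) : ℤ → Type u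
  | Int.ofNat k => X.cells k
  | Int.negSucc 0 => PUnit
  | Int.negSucc (_ + 1) => PEmpty

instance instFintypeCell (X : CellComplex.{u}) : ∀ k : ℤ, Fintype (X.Cell k)
  | Int.ofNat k => X.fintypeCells k
  | Int.negSucc 0 => inferInstanceAs (Fintype PUnit)
  | Int.negSucc (_ + 1) => inferInstanceAs (Fintype PEmpty)

instance instLinearOrderCell (X : CellComplex.{u}) : ∀ k : ℤ, LinearOrder (X.Cell k)
  | Int.ofNat k => X.orderCells k
  | Int.negSucc 0 => inferInstanceAs (LinearOrder PUnit)
  | Int.negSucc (_ + 1) => inferInstanceAs (LinearOrder PEmpty)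

/-- The augmented boundary matrix from `C_k` to `C_j`: it is `∂_k` for `j = k - 1`
(with `∂₀ = (1, …, 1)`), and zero for all other pairs of degrees. -/
def boundary (X : CellComplex.{u}) : ∀ j k : ℤ, Matrix (X.Cell j) (X.Cell k) ℤ
  | Int.ofNat j, Int.ofNat k =>
      if h : k = j + 1 then
        Matrix.of fun (x : X.cells j) (y : X.cells k) => X.bd j x (cast (congrArg X.cells h) y)
      else 0
  | Int.negSucc 0, Int.ofNat 0 => Matrix.of fun _ _ => 1
  | _, _ => 0

theorem boundary_comp (X : CellComplex.{u}) (j k l : ℤ) :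
    X.boundary j k * X.boundary k l = 0 := by
  rcases l with l | l
  swap
  · have : X.boundary k (Int.negSucc l) = 0 := by
      rcases k with k | (_ | k) <;> rfl
    rw [this, Matrix.mul_zero]
  rcases k with k | (_ | k)
  · rcases j with j | (_ | j)
    · by_cases h : k = j + 1
      · subst h
        by_cases h' : l = j + 1 + 1
        · subst h'
          have h1 : X.boundary (Int.ofNat j) (Int.ofNat (j + 1)) = X.bd j := by
            simp only [boundary, dif_pos]; rfl
          have h2 : X.boundary (Int.ofNat (j + 1)) (Int.ofNat (j + 1 + 1)) = X.bd (j + 1) := by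
            simp only [boundary, dif_pos]; rfl
          rw [h1, h2]
          exact X.bd_comp j
        · have : X.boundary (Int.ofNat (j + 1)) (Int.ofNat l) = 0 := by
            simp only [boundary, dif_neg h']
          rw [this, Matrix.mul_zero]
      · have : X.boundary (Int.ofNat j) (Int.ofNat k) = 0 := by
          simp only [boundary, dif_neg h]
        rw [this, Matrix.zero_mul]
    · rcases k with _ | k
      · by_cases h' : l = 0 + 1
        · subst h'
          have h2 : X.boundary (Int.ofNat 0) (Int.ofNat (0 + 1)) = X.bd 0 := by
            simp only [boundary, dif_pos]; rfl
          rw [h2]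
          funext x y
          refine Eq.trans (Finset.sum_congr rfl fun v _ => ?_) (X.aug_comp y)
          exact one_mul (X.bd 0 v y)
        · have : X.boundary (Int.ofNat 0) (Int.ofNat l) = 0 := by
            simp only [boundary, dif_neg h']
          rw [this, Matrix.mul_zero]
      · have : X.boundary (Int.negSucc 0) (Int.ofNat (k + 1)) = 0 := rfl
        rw [this, Matrix.zero_mul]
    · have : X.boundary (Int.negSucc (j + 1)) (Int.ofNat k) = 0 := rfl
      rw [this, Matrix.zero_mul]
  · have : X.boundary j (Int.negSucc 0) = 0 := by
      rcases j with j | (_ | j) <;> rfl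
    rw [this, Matrix.zero_mul]
  · have : X.boundary (Int.negSucc (k + 1)) (Int.ofNat l) = 0 := rfl
    rw [this, Matrix.mul_zero]

/-- The cycles `Z_k = ker ∂_k`. -/
def cycles (X : CellComplex.{u}) (k : ℤ) : Submodule ℤ (X.Cell k → ℤ) :=
  LinearMap.ker (X.boundary (k - 1) k).mulVecLin

/-- The boundaries `B_k = im ∂_{k+1}`. -/
def boundaries (X : CellComplex.{u}) (k : ℤ) : Submodule ℤ (X.Cell k → ℤ) :=
  LinearMap.range (X.boundary k (k + 1)).mulVecLin

/-- The cocycles `Z^k = ker δ_k`, where `δ_k = ∂_{k+1}ᵗ`. -/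
def cocycles (X : CellComplex.{u}) (k : ℤ) : Submodule ℤ (X.Cell k → ℤ) :=
  LinearMap.ker (X.boundary k (k + 1))ᵀ.mulVecLin

/-- The coboundaries `B^k = im δ_{k-1}`, where `δ_{k-1} = ∂_kᵗ`. -/
def coboundaries (X : CellComplex.{u}) (k : ℤ) : Submodule ℤ (X.Cell k → ℤ) :=
  LinearMap.range (X.boundary (k - 1) k)ᵀ.mulVecLin

/-- The reduced homology group `H̃_k(X) = Z_k / B_k`. -/
abbrev Homology (X : CellComplex.{u}) (k : ℤ) : Type u :=
  X.cycles k ⧸ (X.boundaries k).submoduleOf (X.cycles k)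

/-- The reduced cohomology group `H̃^k(X) = Z^k / B^k`. -/
abbrev Cohomology (X : CellComplex.{u}) (k : ℤ) : Type u :=
  X.cocycles k ⧸ (X.coboundaries k).submoduleOf (X.cocycles k)

theorem boundaries_le_cycles (X : CellComplex.{u}) (k : ℤ) : X.boundaries k ≤ X.cycles k := by
  rintro _ ⟨x, rfl⟩
  simp [cycles, Matrix.mulVec_mulVec, boundary_comp]

theorem coboundaries_le_cocycles (X : CellComplex.{u}) (k : ℤ) :
    X.coboundaries k ≤ X.cocycles k := by
  rintro _ ⟨x, rfl⟩
  have h := congrArg Matrix.transpose (X.boundary_comp (k - 1) k (k + 1))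
  rw [Matrix.transpose_mul, Matrix.transpose_zero] at h
  rw [cocycles, LinearMap.mem_ker, Matrix.mulVecLin_apply, Matrix.mulVecLin_apply,
    Matrix.mulVec_mulVec, h, Matrix.zero_mulVec]

theorem boundary_col_mem (X : CellComplex.{u}) (k : ℤ) (e : X.Cell k) :
    (X.boundary (k - 1) k)ᵀ e ∈ X.cycles (k - 1) := by
  have h := X.boundary_comp (k - 1 - 1) (k - 1) k
  simp only [cycles, LinearMap.mem_ker, Matrix.mulVecLin_apply]
  funext a
  exact congrFun (congrFun h a) e

theorem coboundary_col_mem (X : CellComplex.{u}) (k : ℤ) (e : X.Cell k) :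
    X.boundary k (k + 1) e ∈ X.cocycles (k + 1) := by
  have h := congrArg Matrix.transpose (X.boundary_comp k (k + 1) (k + 1 + 1))
  rw [Matrix.transpose_mul, Matrix.transpose_zero] at h
  simp only [cocycles, LinearMap.mem_ker, Matrix.mulVecLin_apply]
  funext a
  exact congrFun (congrFun h a) e

end CellComplex

section LinearAlgebra

variable {b c : Type u} {n r : ℕ}

/-- `[A]_Z`: the columns of the integer matrix `A`, all lying in the lattice `K`, written with
respect to the basis `Z` of `K`. -/
noncomputable def coordMatrix (A : Matrix b c ℤ) (K : Submodule ℤ (b → ℤ)) (hA : ∀ e, Aᵀ e ∈ K)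
    (Z : Basis (Fin n) ℤ K) : Matrix (Fin n) c ℤ :=
  Matrix.of fun k e => Z.repr ⟨Aᵀ e, hA e⟩ k

/-- For an `n × (n+1)` matrix `A`, the vector `v` whose `j`-th entry (counting from one) is
`(-1)^j det [A]_j`, where `[A]_j` is `A` without its `j`-th column. -/
def cofactorVec (A : Matrix (Fin n) (Fin (n + 1)) ℤ) : Fin (n + 1) → ℤ :=
  fun j => (-1) ^ ((j : ℕ) + 1) * (A.submatrix id j.succAbove).det

/-- For a set `I` of `n + 1` columns of `A`, the vector `v_{A|_I}` extended by zero outside `I`. -/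
def circuitVec [LinearOrder c] (A : Matrix (Fin n) c ℤ) (I : Finset c) (hI : I.card = n + 1) :
    c → ℤ :=
  fun e => if h : e ∈ I then
    cofactorVec (A.submatrix id (I.orderEmbOfFin hI)) ((I.orderIsoOfFin hI).symm ⟨e, h⟩) else 0

theorem mulVec_cofactorVec (A : Matrix (Fin n) (Fin (n + 1)) ℤ) : A *ᵥ cofactorVec A = 0 := by
  funext k
  let M : Matrix (Fin (n + 1)) (Fin (n + 1)) ℤ := Matrix.of fun x => A (Fin.cases k id x)
  have h : M.det = 0 :=
    Matrix.det_zero_of_row_eq (i := 0) (j := k.succ) (Fin.succ_ne_zero k).symm rfl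
  rw [Matrix.det_succ_row_zero] at h
  simp only [Matrix.mulVec, dotProduct, cofactorVec, Pi.zero_apply]
  rw [← neg_eq_zero, ← h, ← Finset.sum_neg_distrib]
  refine Finset.sum_congr rfl fun j _ => ?_
  have h1 : M.submatrix Fin.succ j.succAbove = A.submatrix id j.succAbove := rfl
  have h2 : M 0 j = A k j := rfl
  rw [h1, h2, pow_succ]
  ring

theorem mulVec_circuitVec [Fintype c] [LinearOrder c] (A : Matrix (Fin n) c ℤ) (I : Finset c)
    (hI : I.card = n + 1) : A *ᵥ circuitVec A I hI = 0 := by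
  funext k
  have h := congrFun (mulVec_cofactorVec (A.submatrix id (I.orderEmbOfFin hI))) k
  rw [← h]
  simp only [Matrix.mulVec, dotProduct]
  rw [← Finset.sum_subset (Finset.subset_univ I) (fun e _ he => by simp [circuitVec, he]),
    ← Finset.sum_coe_sort I]
  refine (Fintype.sum_equiv (I.orderIsoOfFin hI).toEquiv _ _ fun j => ?_).symm
  have h1 : circuitVec A I hI ((I.orderIsoOfFin hI).toEquiv j : c) =
      cofactorVec (A.submatrix id (I.orderEmbOfFin hI)) j := by
    rw [circuitVec, dif_pos ((I.orderIsoOfFin hI).toEquiv j).2]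
    congr 1
    exact (I.orderIsoOfFin hI).symm_apply_apply j
  rw [h1]
  rfl

theorem mulVec_circuitVec_coordMatrix [Fintype c] [LinearOrder c] (A : Matrix b c ℤ)
    (K : Submodule ℤ (b → ℤ)) (hA : ∀ e, Aᵀ e ∈ K) (Z : Basis (Fin n) ℤ K) (I : Finset c)
    (hI : I.card = n + 1) : A *ᵥ circuitVec (coordMatrix A K hA Z) I hI = 0 := by
  have h (k : Fin n) := congrFun (mulVec_circuitVec (coordMatrix A K hA Z) I hI) k
  generalize circuitVec (coordMatrix A K hA Z) I hI = v at h
  have h0 : (∑ e, v e • (⟨Aᵀ e, hA e⟩ : K)) = 0 := by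
    apply Z.repr.injective
    ext k
    have hk := h k
    simp only [Matrix.mulVec, dotProduct, coordMatrix, Matrix.of_apply, Pi.zero_apply] at hk
    rw [map_sum, Finsupp.finsetSum_apply, map_zero, Finsupp.zero_apply, ← hk]
    refine Finset.sum_congr rfl fun e _ => ?_
    rw [map_smul, Finsupp.smul_apply, smul_eq_mul, mul_comm]
  have h1 := congrArg K.subtype h0
  rw [map_sum, map_zero] at h1
  funext x
  have h2 := congrFun h1 x
  rw [Finset.sum_apply] at h2
  rw [← h2]
  exact Finset.sum_congr rfl fun e _ => mul_comm _ _

/-- For lattices `B ≤ Z` with bases `β` of `B` and `ζ` of `Z`, the latter having one element more,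
the determinant `det([z]_ζ, [β]_ζ)` whose columns are the coordinates of `z` and of the elements
of `β` with respect to `ζ`. -/
noncomputable def detAlong {B Z : Submodule ℤ (c → ℤ)} (hBZ : B ≤ Z)
    (ζ : Basis (Fin (r + 1)) ℤ Z) (β : Basis (Fin r) ℤ B) (z : Z) : ℤ :=
  (Matrix.of fun k j : Fin (r + 1) =>
    ζ.repr ((Fin.cons z fun s => Submodule.inclusion hBZ (β s) : Fin (r + 1) → Z) j) k).det

end LinearAlgebra

namespace CellComplex

/-- The unicycle condition: `rk H̃_{i+1}(X) = 0`, `rk H̃_i(X) = 1` and `rk H̃_{i-1}(X) = 0`. -/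
def Unicycle (X : CellComplex.{u}) (i : ℤ) : Prop :=
  finrank ℤ (X.Homology (i + 1)) = 0 ∧ finrank ℤ (X.Homology i) = 1 ∧
    finrank ℤ (X.Homology (i - 1)) = 0

/-- The `i`-dimensional cycletrees `U = X^{i-1} ∪ I(U)`, given by their sets `I(U)` of `i`-cells:
`|I(U)| = rk Z_{i-1}(X) + 1`. -/
abbrev Cycletree (X : CellComplex.{u}) (i : ℤ) : Type u :=
  {I : Finset (X.Cell i) // I.card = finrank ℤ (X.cycles (i - 1)) + 1}

/-- The `i`-dimensional dual cycletrees `U* = X^{i-1} ∪ I(U*)`, given by their sets `I(U*)` of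
`i`-cells: `|I(U*)| = rk Z^{i+1}(X) + 1`. -/
abbrev DualCycletree (X : CellComplex.{u}) (i : ℤ) : Type u :=
  {I : Finset (X.Cell i) // I.card = finrank ℤ (X.cocycles (i + 1)) + 1}

/-- The cycle part `C_U` of a cycletree `U`, built from the matrix `[∂_i]_η` of `∂_i` with respect
to a basis `η` of `Z_{i-1}`. -/
noncomputable def cyclePart (X : CellComplex.{u}) (i : ℤ)
    (η : Basis (Fin (finrank ℤ (X.cycles (i - 1)))) ℤ (X.cycles (i - 1)))
    (U : X.Cycletree i) : X.cycles i :=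
  ⟨circuitVec (coordMatrix (X.boundary (i - 1) i) _ (X.boundary_col_mem i) η) U.1 U.2,
    mulVec_circuitVec_coordMatrix _ _ _ _ _ _⟩

/-- The cocycle part `C_{U*}` of a dual cycletree `U*`, built from the matrix `[δ_i]_η` of `δ_i`
with respect to a basis `η` of `Z^{i+1}`. -/
noncomputable def cocyclePart (X : CellComplex.{u}) (i : ℤ)
    (η : Basis (Fin (finrank ℤ (X.cocycles (i + 1)))) ℤ (X.cocycles (i + 1)))
    (U : X.DualCycletree i) : X.cocycles i :=
  ⟨circuitVec (coordMatrix (X.boundary i (i + 1))ᵀ _ (X.coboundary_col_mem i) η) U.1 U.2,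
    mulVec_circuitVec_coordMatrix _ _ _ _ _ _⟩

/-- The winding number `w(z) = det([z]_ζ, [β]_ζ)` of a cycle `z`, for a basis `ζ` of `Z_i` and a
basis `β` of `B_i = im ∂_{i+1}`. -/
noncomputable def winding (X : CellComplex.{u}) (i : ℤ)
    (ζ : Basis (Fin (finrank ℤ (X.boundaries i) + 1)) ℤ (X.cycles i))
    (β : Basis (Fin (finrank ℤ (X.boundaries i))) ℤ (X.boundaries i)) (z : X.cycles i) : ℤ :=
  detAlong (X.boundaries_le_cycles i) ζ β z

/-- The cutting number `c(z) = det([z]_ζ, [β]_ζ)` of a cocycle `z`, for a basis `ζ` of `Z^i` and a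
basis `β` of `B^i = im δ_{i-1}`. -/
noncomputable def cutting (X : CellComplex.{u}) (i : ℤ)
    (ζ : Basis (Fin (finrank ℤ (X.coboundaries i) + 1)) ℤ (X.cocycles i))
    (β : Basis (Fin (finrank ℤ (X.coboundaries i))) ℤ (X.coboundaries i))
    (z : X.cocycles i) : ℤ :=
  detAlong (X.coboundaries_le_cocycles i) ζ β z

/-- The standard harmonic cycle `λ = ∑_U w(C_U) C_U`, the sum being over all `i`-cycletrees. -/
noncomputable def stdHarmonicCycle (X : CellComplex.{u}) (i : ℤ)
    (η : Basis (Fin (finrank ℤ (X.cycles (i - 1)))) ℤ (X.cycles (i - 1)))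
    (ζ : Basis (Fin (finrank ℤ (X.boundaries i) + 1)) ℤ (X.cycles i))
    (β : Basis (Fin (finrank ℤ (X.boundaries i))) ℤ (X.boundaries i)) : X.cycles i :=
  ∑ U : X.Cycletree i, X.winding i ζ β (X.cyclePart i η U) • X.cyclePart i η U

/-- The standard harmonic cocycle `λ* = ∑_{U*} c(C_{U*}) C_{U*}`, the sum being over all dual
`i`-cycletrees. -/
noncomputable def stdHarmonicCocycle (X : CellComplex.{u}) (i : ℤ)
    (η : Basis (Fin (finrank ℤ (X.cocycles (i + 1)))) ℤ (X.cocycles (i + 1)))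
    (ζ : Basis (Fin (finrank ℤ (X.coboundaries i) + 1)) ℤ (X.cocycles i))
    (β : Basis (Fin (finrank ℤ (X.coboundaries i))) ℤ (X.coboundaries i)) : X.cocycles i :=
  ∑ U : X.DualCycletree i, X.cutting i ζ β (X.cocyclePart i η U) • X.cocyclePart i η U

end CellComplex

/-! Let `A` be the matrix of `∂_i` in a basis of `Z_{i-1}`. Up to sign, the `e`-th coordinate of `λ
/ |H̃_{i-1}|` is the determinant `x_e` whose rows are the unit vector at `e`, a basis of `B_i`, and
the rows of `A`. As `Z_{i-1}` is saturated, the rows of `A` form a basis of `B^i`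
(`exists_basis_range_transpose`). The dual computation yields the same determinant with `B_i` and
`B^i` exchanged, which costs one sign independent of `e` (`exists_units_det_eq_of_bases`).

To find `λ`: the vector `x` represents `z ↦ det(z, B_i, A)`, so it lies in `ker A` and pairs with a
cycle `z` to `w(z) D`, where `D = det(ζ, A)` for a basis `ζ` of `Z_i`. Cauchy–Binet gives `∑_U ⟨x,
C_U⟩ C_U = det(A Aᵗ) x` (`sum_dotProduct_circuitVec_mul_apply`), that is, `D λ = det(A Aᵗ) x`. Since
`det(A Aᵗ) = ± |coker A| D` (`exists_equiv_det_fromRows_ker`) and `coker A ≅ H̃_{i-1}`, the nonzero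
factor `D` cancels. -/

namespace Matrix

/-! ### Cauchy–Binet -/

/-- The Cauchy–Binet formula. -/
theorem det_mul_transpose_eq_sum {R c : Type*} [CommRing R] [Fintype c] [LinearOrder c] {k : ℕ}
    (M N : Matrix (Fin k) c R) :
    (N * Mᵀ).det = ∑ I : {I : Finset c // I.card = k},
      (M.submatrix id (I.1.orderEmbOfFin I.2)).det *
        (N.submatrix id (I.1.orderEmbOfFin I.2)).det := by
  -- Both sides are alternating in the rows of `N`, so it suffices to compare them on distinct
  -- standard basis vectors.
  let f : (c → R) [⋀^Fin k]→ₗ[R] R := detRowAlternating.compLinearMap Mᵀ.vecMulLinear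
  let g : (c → R) [⋀^Fin k]→ₗ[R] R := ∑ I : {I : Finset c // I.card = k},
    (M.submatrix id (I.1.orderEmbOfFin I.2)).det •
      detRowAlternating.compLinearMap (LinearMap.funLeft R R (I.1.orderEmbOfFin I.2))
  have hg (N : Fin k → c → R) : g N = ∑ I : {I : Finset c // I.card = k},
      (M.submatrix id (I.1.orderEmbOfFin I.2)).det *
        (Matrix.of fun a b => N a (I.1.orderEmbOfFin I.2 b)).det :=
    map_sum (⟨⟨fun F => F N, rfl⟩, fun _ _ => rfl⟩ :
      ((c → R) [⋀^Fin k]→ₗ[R] R) →+ R) _ Finset.univ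
  suffices h : f = g from (congrArg (fun F => F N) h).trans (hg N)
  refine Basis.ext_alternating (Pi.basisFun R c) fun v hv => ?_
  have hI : (Finset.univ.image v).card = k := by
    rw [Finset.card_image_of_injective _ hv, Finset.card_univ, Fintype.card_fin]
  let emb := (Finset.univ.image v).orderEmbOfFin hI
  let iso := (Finset.univ.image v).orderIsoOfFin hI
  let w : Fin k → Fin k := fun a => iso.symm ⟨v a, Finset.mem_image_of_mem v (Finset.mem_univ a)⟩
  have hw (a : Fin k) : emb (w a) = v a :=
    congrArg Subtype.val (iso.apply_symm_apply _)
  have hwinj : Function.Injective w := fun a b hab => hv <| by rw [← hw, ← hw, hab]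
  let τ : Equiv.Perm (Fin k) := Equiv.ofBijective w (Finite.injective_iff_bijective.1 hwinj)
  -- Only the column set `image v` contributes, and there both sides carry the sign of the
  -- permutation `τ` sorting `v`.
  rw [hg, Finset.sum_eq_single ⟨Finset.univ.image v, hI⟩]
  · have h1 : (detRowAlternating.compLinearMap Mᵀ.vecMulLinear fun a => Pi.basisFun R c (v a)) =
        ((M.submatrix id emb)ᵀ.submatrix τ id).det := by
      change det _ = _
      congr 1
      ext a b
      simp [τ, hw]
    have h2 : (Matrix.of fun a b => Pi.basisFun R c (v a) (emb b)).det =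
        ((1 : Matrix (Fin k) (Fin k) R).submatrix τ id).det := by
      congr 1
      ext a b
      simp [τ, ← hw a, Pi.single_apply, one_apply, eq_comm]
    refine h1.trans ((congrArg _ h2).trans ?_).symm
    rw [det_permute, det_permute, det_one, det_transpose, mul_one]
    exact mul_comm _ _
  · rintro ⟨I, hI'⟩ - hne
    obtain ⟨a, ha⟩ : ∃ a, v a ∉ I := by
      by_contra! h
      refine hne (Subtype.ext (Finset.eq_of_subset_of_card_le ?_ ?_).symm)
      · intro x hx
        obtain ⟨a, -, rfl⟩ := Finset.mem_image.1 hx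
        exact h a
      · rw [hI, hI']
    refine mul_eq_zero_of_right _ (det_eq_zero_of_row_eq_zero a fun b => ?_)
    have : I.orderEmbOfFin hI' b ≠ v a := fun h => ha (h ▸ Finset.orderEmbOfFin_mem I hI' b)
    simp [this]
  · simp

/-- The matrix `A` with the row `x` put on top. -/
abbrev consRow {R c : Type*} {n : ℕ} (x : c → R) (A : Matrix (Fin n) c R) :
    Matrix (Fin (n + 1)) c R :=
  of (vecCons x A)

end Matrix

/-! ### Pairings with circuit vectors -/

theorem circuitVec_orderEmbOfFin {c : Type*} [LinearOrder c] {n : ℕ} (A : Matrix (Fin n) c ℤ)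
    (I : Finset c) (hI : I.card = n + 1) (j : Fin (n + 1)) :
    circuitVec A I hI (I.orderEmbOfFin hI j) =
      cofactorVec (A.submatrix id (I.orderEmbOfFin hI)) j := by
  rw [circuitVec, dif_pos (Finset.orderEmbOfFin_mem I hI j)]
  congr 1
  exact (I.orderIsoOfFin hI).symm_apply_apply j

/-- Pairing a vector with a circuit vector is, up to sign, the maximal minor obtained by putting
the vector on top of the matrix. -/
theorem dotProduct_circuitVec {c : Type*} [Fintype c] [LinearOrder c] {n : ℕ}
    (A : Matrix (Fin n) c ℤ) (I : Finset c) (hI : I.card = n + 1) (x : c → ℤ) :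
    x ⬝ᵥ circuitVec A I hI =
      -((consRow x A).submatrix id (I.orderEmbOfFin hI)).det := by
  rw [det_succ_row_zero, ← Finset.sum_neg_distrib, dotProduct,
    ← Finset.sum_subset (Finset.subset_univ I) (fun e _ he => by simp [circuitVec, he]),
    ← Finset.sum_coe_sort I]
  refine (Fintype.sum_equiv (I.orderIsoOfFin hI).toEquiv _ _ fun j => ?_).symm
  have h : circuitVec A I hI ((I.orderIsoOfFin hI).toEquiv j : c) = _ :=
    circuitVec_orderEmbOfFin A I hI j
  -- Cofactor signs count columns from one, Laplace expansion from zero: hence the global minus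
  -- sign.
  rw [h, cofactorVec, pow_succ]
  have h1 : ((consRow x A).submatrix id (I.orderEmbOfFin hI)).submatrix
      Fin.succ j.succAbove = (A.submatrix id (I.orderEmbOfFin hI)).submatrix id j.succAbove := rfl
  have h2 : (consRow x A).submatrix id (I.orderEmbOfFin hI) 0 j =
    x ((I.orderIsoOfFin hI).toEquiv j) := rfl
  rw [h1, h2]
  ring

/-- A form of the Cauchy–Binet formula for circuit vectors. -/
theorem sum_dotProduct_circuitVec_mul {c : Type*} [Fintype c] [LinearOrder c] {n : ℕ}
    (A : Matrix (Fin n) c ℤ) (x y : c → ℤ) :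
    ∑ I : {I : Finset c // I.card = n + 1},
      (x ⬝ᵥ circuitVec A I.1 I.2) * (y ⬝ᵥ circuitVec A I.1 I.2) =
      (consRow y A * (consRow x A)ᵀ).det := by
  simp only [dotProduct_circuitVec, neg_mul_neg, Matrix.det_mul_transpose_eq_sum]

/-- If `x` is orthogonal to the rows of `A`, the circuit vectors weighted by their pairings with
`x` add up to a multiple of `x`. -/
theorem sum_dotProduct_circuitVec_mul_apply {c : Type*} [Fintype c] [LinearOrder c] {n : ℕ}
    (A : Matrix (Fin n) c ℤ) (x : c → ℤ) (hx : A *ᵥ x = 0) (e : c) :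
    ∑ I : {I : Finset c // I.card = n + 1},
      (x ⬝ᵥ circuitVec A I.1 I.2) * circuitVec A I.1 I.2 e = x e * (A * Aᵀ).det := by
  have h := sum_dotProduct_circuitVec_mul A x (Pi.single e 1)
  simp only [single_one_dotProduct] at h
  -- The first column is `x e` followed by `A *ᵥ x = 0`, so a single term of the expansion survives.
  rw [h, det_succ_column_zero, Fin.sum_univ_succ, Finset.sum_eq_zero, add_zero]
  · have h1 : (consRow (Pi.single e 1) A * (consRow x A)ᵀ) 0 0 = x e :=
      single_one_dotProduct e x
    have h2 : (consRow (Pi.single e 1) A * (consRow x A)ᵀ).submatrix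
      (Fin.succAbove 0) Fin.succ = A * Aᵀ := rfl
    rw [h1, h2]
    simp
  · intro j _
    have h1 : (consRow (Pi.single e 1) A * (consRow x A)ᵀ) j.succ 0 = 0 :=
      congrFun hx j
    rw [h1]
    simp

/-! ### Ranks, finite quotients and Gram matrices over the integers -/

theorem Module.finrank_int_eq_zero_iff_finite (M : Type*) [AddCommGroup M] [Module.Finite ℤ M] :
    finrank ℤ M = 0 ↔ Finite M := by
  rw [Module.finrank_eq_zero_iff_isTorsion]
  refine ⟨fun h => Module.finite_of_fg_torsion M h, fun _ x => ?_⟩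
  exact ⟨⟨Nat.card M, mem_nonZeroDivisors_of_ne_zero (Nat.cast_ne_zero.2 Nat.card_pos.ne')⟩, by
    simp [Submonoid.smul_def]⟩

namespace Matrix

/-- Positivity: `x ⬝ᵥ (Aᵀ * A) *ᵥ x` is the squared length of `A *ᵥ x`. -/
theorem ker_transpose_mul_self {b c : Type*} [Fintype b] [Fintype c] (A : Matrix b c ℤ) :
    LinearMap.ker (Aᵀ * A).mulVecLin = LinearMap.ker A.mulVecLin := by
  ext x
  simp only [LinearMap.mem_ker, mulVecLin_apply, ← mulVec_mulVec]
  refine ⟨fun h => ?_, fun h => by rw [h, mulVec_zero]⟩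
  replace h := congrArg (x ⬝ᵥ ·) h
  rwa [dotProduct_mulVec, dotProduct_zero, vecMul_transpose, dotProduct_self_eq_zero] at h

/-- `Aᵀ * A` has the kernel of `A`, hence its rank, while its range lies inside that of `Aᵀ`. -/
theorem finrank_range_le_transpose {b c : Type*} [Fintype b] [Fintype c] (A : Matrix b c ℤ) :
    finrank ℤ (LinearMap.range A.mulVecLin) ≤ finrank ℤ (LinearMap.range Aᵀ.mulVecLin) := by
  have h1 := Submodule.finrank_quotient_add_finrank (LinearMap.ker (Aᵀ * A).mulVecLin)
  have h2 := Submodule.finrank_quotient_add_finrank (LinearMap.ker A.mulVecLin)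
  rw [(LinearMap.quotKerEquivRange _).finrank_eq] at h1 h2
  rw [ker_transpose_mul_self] at h1
  have h3 : finrank ℤ (LinearMap.range (Aᵀ * A).mulVecLin) ≤
      finrank ℤ (LinearMap.range Aᵀ.mulVecLin) := by
    rw [mulVecLin_mul]
    exact Submodule.finrank_mono (LinearMap.range_comp_le_range _ _)
  omega

theorem finrank_range_transpose {b c : Type*} [Fintype b] [Fintype c] (A : Matrix b c ℤ) :
    finrank ℤ (LinearMap.range Aᵀ.mulVecLin) = finrank ℤ (LinearMap.range A.mulVecLin) :=
  le_antisymm (finrank_range_le_transpose Aᵀ) (finrank_range_le_transpose A)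

theorem det_mul_transpose_ne_zero {c : Type*} [Fintype c] {n : ℕ} (A : Matrix (Fin n) c ℤ)
    (hA : LinearIndependent ℤ A.row) : (A * Aᵀ).det ≠ 0 := by
  rw [Ne, ← exists_mulVec_eq_zero_iff]
  rintro ⟨v, hv, h⟩
  have h1 : v ∈ LinearMap.ker (Aᵀᵀ * Aᵀ).mulVecLin := h
  rw [ker_transpose_mul_self, LinearMap.mem_ker, mulVecLin_apply,
    mulVec_transpose] at h1
  refine hv (funext fun k => Fintype.linearIndependent_iff.1 hA v ?_ k)
  rw [← h1, vecMul_eq_sum]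
  rfl

/-! ### Determinants with a variable first row -/

section

variable {c : Type*} [Fintype c] [DecidableEq c] {r n : ℕ}

/-- Linearity in the first row; `σ` merely matches row indices with columns to make the matrix
square. -/
theorem det_fromRows_consRow (σ : Fin (r + 1) ⊕ Fin n ≃ c) (B : Matrix (Fin r) c ℤ)
    (A : Matrix (Fin n) c ℤ) (z : c → ℤ) :
    ((fromRows (consRow z B) A).submatrix id σ).det =
      (fun e => ((fromRows (consRow (Pi.single e 1) B) A).submatrix id σ).det) ⬝ᵥ z := by
  let f : (c → ℤ) →ₗ[ℤ] ℤ :=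
    ((detRowAlternating (R := ℤ) (n := Fin (r + 1) ⊕ Fin n)).toMultilinearMap.toLinearMap
      ((fromRows (consRow 0 B) A).submatrix id σ) (Sum.inl 0)) ∘ₗ LinearMap.funLeft ℤ ℤ σ
  have hf (z : c → ℤ) : f z = ((fromRows (consRow z B) A).submatrix id σ).det := by
    change det _ = _
    congr 1
    ext a b
    rcases a with a | a
    · refine Fin.cases ?_ (fun a => ?_) a
      · exact congrFun (Function.update_self (β := fun _ => Fin (r + 1) ⊕ Fin n → ℤ) _ _ _) b
      · exact congrFun (Function.update_of_ne (β := fun _ => Fin (r + 1) ⊕ Fin n → ℤ)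
          (by simp) _ _) b
    · exact congrFun (Function.update_of_ne (β := fun _ => Fin (r + 1) ⊕ Fin n → ℤ)
        (by simp) _ _) b
  rw [← hf, LinearMap.pi_apply_eq_sum_univ]
  refine Finset.sum_congr rfl fun e _ => ?_
  have : (fun j => if e = j then (1 : ℤ) else 0) = Pi.single e 1 := by
    ext j; simp [Pi.single_apply, eq_comm]
  rw [this, hf, smul_eq_mul, mul_comm]

/-- Pairing with a row of `A` puts that row on top, so the determinant has a repeated row. -/
theorem mulVec_det_fromRows_consRow (σ : Fin (r + 1) ⊕ Fin n ≃ c) (B : Matrix (Fin r) c ℤ)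
    (A : Matrix (Fin n) c ℤ) :
    A *ᵥ (fun e => ((fromRows (consRow (Pi.single e 1) B) A).submatrix id σ).det) = 0 := by
  ext k
  rw [mulVec, dotProduct_comm, ← det_fromRows_consRow]
  exact det_zero_of_row_eq (i := Sum.inl 0) (j := Sum.inr k) (by simp) rfl

/-- Expanding `z` and `β` in the basis `ζ` factors the right-hand matrix as a block diagonal matrix,
with the transposed coordinates and an identity block, times the matrix of `ζ` and `A`. -/
theorem detAlong_mul_det_fromRows {c : Type u} [Fintype c] [DecidableEq c]
    {B Z : Submodule ℤ (c → ℤ)} (hBZ : B ≤ Z)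
    (ζ : Basis (Fin (r + 1)) ℤ Z) (β : Basis (Fin r) ℤ B) (z : Z) (A : Matrix (Fin n) c ℤ)
    (σ : Fin (r + 1) ⊕ Fin n ≃ c) :
    detAlong hBZ ζ β z * ((fromRows (of fun k => (ζ k).1) A).submatrix id σ).det =
      ((fromRows (consRow z.1 (of fun k => (β k).1)) A).submatrix id σ).det := by
  let v : Fin (r + 1) → Z := Fin.cons z fun s => Submodule.inclusion hBZ (β s)
  let T : Matrix (Fin (r + 1)) (Fin (r + 1)) ℤ := of fun k j => ζ.repr (v j) k
  have hv : T.transpose * (of fun k => (ζ k).1) = consRow z.1 (of fun k => (β k).1) := by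
    have h1 (j : Fin (r + 1)) : (v j).1 = vecCons z.1 (fun k => (β k).1) j := by
      refine Fin.cases rfl (fun _ => rfl) j
    ext j e
    refine Eq.trans ?_ (congrFun (h1 j) e)
    have h3 := congrArg (fun x : Z => x.1 e) (ζ.sum_repr (v j))
    simp only [AddSubmonoidClass.coe_finsetSum, Finset.sum_apply] at h3
    exact h3
  let Q : Matrix (Fin (r + 1) ⊕ Fin n) (Fin (r + 1) ⊕ Fin n) ℤ := fromBlocks T.transpose 0 0 1
  have h : fromRows (consRow z.1 (of fun k => (β k).1)) A =
      Q * fromRows (of fun k => (ζ k).1) A := by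
    rw [fromBlocks_mul_fromRows, hv]
    simp
  have h2 : (fromRows (consRow z.1 (of fun k => (β k).1)) A).submatrix id σ =
      Q * (fromRows (of fun k => (ζ k).1) A).submatrix id σ := by
    rw [h]; rfl
  rw [h2, det_mul, det_fromBlocks_zero₂₁, det_one, mul_one, det_transpose]
  rfl

end

/-! ### Kernel bases and the order of the cokernel -/

theorem exists_basis_fin_range {c : Type*} [Fintype c] {n : ℕ} (A : Matrix (Fin n) c ℤ)
    [Finite ((Fin n → ℤ) ⧸ LinearMap.range A.mulVecLin)] :
    Nonempty (Basis (Fin n) ℤ (LinearMap.range A.mulVecLin)) := by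
  have h1 := Submodule.finrank_quotient_add_finrank (LinearMap.range A.mulVecLin)
  rw [(Module.finrank_int_eq_zero_iff_finite _).2 inferInstance, zero_add,
    Module.finrank_fin_fun] at h1
  exact ⟨Module.finBasisOfFinrankEq ℤ _ h1⟩

/-- The determinant formed by a basis of the kernel of `A` and the rows of `A`. -/
theorem exists_equiv_det_fromRows_ker {c : Type*} [Fintype c] [DecidableEq c] {r n : ℕ}
    (A : Matrix (Fin n) c ℤ) [Finite ((Fin n → ℤ) ⧸ LinearMap.range A.mulVecLin)]
    (ζ : Basis (Fin r) ℤ (LinearMap.ker A.mulVecLin)) :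
    ∃ (σ : Fin r ⊕ Fin n ≃ c) (ε : ℤˣ),
      ((fromRows (of fun k => (ζ k).1) A).submatrix id σ).det ≠ 0 ∧
      (A * Aᵀ).det = ε * Nat.card ((Fin n → ℤ) ⧸ LinearMap.range A.mulVecLin) *
        ((fromRows (of fun k => (ζ k).1) A).submatrix id σ).det := by
  obtain ⟨γ⟩ := exists_basis_fin_range A
  -- Preimages of a basis `γ` of the range complete `ζ` to a basis of the whole lattice; `P` below
  -- consists of these preimages.
  let b := Basis.sumQuot ζ (γ.map A.mulVecLin.quotKerEquivRange.symm)
  have hbl (k : Fin r) : b (Sum.inl k) = (ζ k).1 := Basis.sumQuot_inl _ _ k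
  have hbr (k : Fin n) : A *ᵥ b (Sum.inr k) = (γ k).1 := by
    have h := Basis.sumQuot_inr ζ (γ.map A.mulVecLin.quotKerEquivRange.symm) k
    refine (congrArg (fun x => (A.mulVecLin.quotKerEquivRange x).1) h).trans ?_
    simp
  let σ : Fin r ⊕ Fin n ≃ c := Fintype.equivOfCardEq (by
    rw [← finrank_eq_card_basis b, Module.finrank_fintype_fun_eq_card])
  set Zm : Matrix (Fin r) c ℤ := of fun k => (ζ k).1 with hZm
  let P : Matrix (Fin n) c ℤ := of fun k => b (Sum.inr k)
  set D := ((fromRows Zm A).submatrix id σ).det with hD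
  have hAZ : A * Zmᵀ = 0 := by
    ext k l
    exact congrFun (LinearMap.mem_ker.1 (ζ l).2) k
  have hAP : (A * Pᵀ).det = (Pi.basisFun ℤ (Fin n)).det (Subtype.val ∘ γ) := by
    rw [Basis.det_apply]
    congr 1
    ext k l
    simp [Basis.toMatrix_apply, ← hbr, mul_apply, mulVec, dotProduct, P]
  have hM : IsUnit ((fromRows Zm P).submatrix id σ).det := by
    have h := Basis.isUnit_det ((Pi.basisFun ℤ c).reindex σ.symm) b
    rw [Basis.det_apply, ← det_transpose] at h
    suffices e : (fromRows Zm P).submatrix id σ =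
        (((Pi.basisFun ℤ c).reindex σ.symm).toMatrix b)ᵀ by rwa [e]
    ext x y
    rcases x with x | x <;> simp [Basis.toMatrix_apply, hbl, Zm, P]
  have hZZ : (Zm * Zmᵀ).det ≠ 0 := by
    refine det_mul_transpose_ne_zero Zm ?_
    exact ζ.linearIndependent.map' (Submodule.subtype _) (Submodule.ker_subtype _)
  -- Multiplying by the transpose of the unimodular matrix `(Zm, P)` gives a block triangular
  -- product, because `A` kills `Zm`. Using `(Zm, A)` itself in its place gives `e2`.
  have e1 : D * ((fromRows Zm P).submatrix id σ).det =
      (Zm * Zmᵀ).det * (Pi.basisFun ℤ (Fin n)).det (Subtype.val ∘ γ) := by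
    rw [hD, ← det_transpose ((fromRows Zm P).submatrix id σ), ← det_mul, transpose_submatrix,
      submatrix_mul_equiv, transpose_fromRows, fromRows_mul_fromCols, hAZ, submatrix_id_id,
      det_fromBlocks_zero₂₁, hAP]
  have e2 : D * D = (Zm * Zmᵀ).det * (A * Aᵀ).det := by
    conv_lhs => rw [hD]; arg 2; rw [← det_transpose]
    rw [← det_mul, transpose_submatrix,
      submatrix_mul_equiv, transpose_fromRows, fromRows_mul_fromCols, hAZ, submatrix_id_id,
      det_fromBlocks_zero₂₁]
  have hcard := Submodule.natAbs_det_basis_change (Pi.basisFun ℤ (Fin n)) _ γ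
  set d := (Pi.basisFun ℤ (Fin n)).det (Subtype.val ∘ γ) with hd
  obtain ⟨ε, hε⟩ := hM
  rw [← hε] at e1
  obtain ⟨ε', hε'⟩ : ∃ ε' : ℤˣ, d = ε' * (d.natAbs : ℤ) := by
    rcases Int.natAbs_eq d with h | h
    · exact ⟨1, by simpa using h⟩
    · exact ⟨-1, by simpa using h⟩
  have hd0 : d ≠ 0 := by
    rw [← Int.natAbs_ne_zero, hcard]
    exact Nat.card_pos.ne'
  have hD0 : D ≠ 0 := by
    intro h
    rw [h, zero_mul] at e1
    exact mul_ne_zero hZZ hd0 e1.symm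
  refine ⟨σ, ε⁻¹ * ε', hD0, ?_⟩
  have hεε : (ε : ℤ) * ((ε⁻¹ : ℤˣ) : ℤ) = 1 := by simp
  -- After multiplication by the Gram determinant of `Zm` the left side is `D * D` by `e2`; `e1`
  -- then evaluates one factor `D` as a unit times the Gram determinant times `d`, where `|d|` is
  -- the index of the range.
  refine mul_left_cancel₀ hZZ ?_
  rw [← e2, ← hcard, Units.val_mul]
  calc D * D = (D * ε) * ((ε⁻¹ : ℤˣ) : ℤ) * D := by rw [mul_assoc D, hεε, mul_one]
    _ = _ := by rw [e1]; conv_lhs => rw [hε']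
                ring

end Matrix

/-! ### Exchanging bases and blocks up to a uniform sign -/

namespace Matrix

/-- The two reindexings differ by a fixed permutation of columns, so its sign serves all `M` at
once. -/
theorem exists_units_det_submatrix_equiv {S S' T c : Type*} [Fintype S] [DecidableEq S]
    [Fintype S'] [DecidableEq S'] [Fintype T] [DecidableEq T]
    (π : S ≃ T) (σ : S ≃ c) (τ : S' ≃ T) (σ' : S' ≃ c) :
    ∃ ε : ℤˣ, ∀ M : Matrix T c ℤ, (M.submatrix π σ).det = ε * (M.submatrix τ σ').det := by
  let p : Equiv.Perm T := (π.symm.trans σ).trans (τ.symm.trans σ').symm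
  refine ⟨Equiv.Perm.sign p, fun M => ?_⟩
  have h1 : M.submatrix π σ =
      (((M.submatrix id (τ.symm.trans σ')).submatrix id p).submatrix π π) := by
    ext a b
    simp [p]
  have h2 : M.submatrix τ σ' = ((M.submatrix id (τ.symm.trans σ')).submatrix τ τ) := by
    ext a b
    simp
  rw [h1, h2, det_submatrix_equiv_self, det_submatrix_equiv_self, det_permute']
  simp

/-- The equivalence moving the first row of the upper block into a block of its own. -/
def splitFirstRow (r n : ℕ) : Fin (r + 1) ⊕ Fin n ≃ Unit ⊕ (Fin r ⊕ Fin n) :=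
  (Equiv.sumCongr ((finSuccEquiv r).trans
    ((Equiv.optionEquivSumPUnit _).trans (Equiv.sumComm _ _))) (Equiv.refl _)).trans
    (Equiv.sumAssoc _ _ _)

theorem fromRows_consRow {c : Type*} {r n : ℕ} (x : c → ℤ) (B : Matrix (Fin r) c ℤ)
    (A : Matrix (Fin n) c ℤ) :
    fromRows (consRow x B) A =
      (fromRows (of fun _ : Unit => x) (fromRows B A)).submatrix (splitFirstRow r n) id := by
  ext a e
  rcases a with a | a
  · exact Fin.cases rfl (fun _ => rfl) a
  · rfl

/-- Basis changes inside `B` and `B'` are unimodular, and swapping the blocks is a permutation.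
Neither involves `x`, which is what makes the sign common to all coordinates. -/
theorem exists_units_det_eq_of_bases {c : Type*} {r n r' n' : ℕ}
    {B B' : Submodule ℤ (c → ℤ)} (β : Basis (Fin r) ℤ B) (α' : Basis (Fin n') ℤ B)
    (α : Basis (Fin n) ℤ B') (β' : Basis (Fin r') ℤ B')
    (σ : Fin (r + 1) ⊕ Fin n ≃ c) (σ' : Fin (r' + 1) ⊕ Fin n' ≃ c) :
    ∃ ε : ℤˣ, ∀ x : c → ℤ,
      ((fromRows (consRow x (of fun k => (β k).1)) (of fun k => (α k).1)).submatrix id σ).det =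
        ε * ((fromRows (consRow x (of fun k => (β' k).1))
          (of fun k => (α' k).1)).submatrix id σ').det := by
  obtain rfl : r = n' := by simpa using Fintype.card_congr (β.indexEquiv α')
  obtain rfl : n = r' := by simpa using Fintype.card_congr (α.indexEquiv β')
  have key {k : ℕ} {L : Submodule ℤ (c → ℤ)} (f g : Basis (Fin k) ℤ L) :
      (of fun a => (f a).1 : Matrix (Fin k) c ℤ) = (g.toMatrix f)ᵀ * of fun a => (g a).1 := by
    ext a e
    have h := congrArg (fun x : L => x.1 e) (g.sum_repr (f a))
    simp only [AddSubmonoidClass.coe_finsetSum, Finset.sum_apply] at h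
    exact h.symm
  have hdet {k : ℕ} {L : Submodule ℤ (c → ℤ)} (f g : Basis (Fin k) ℤ L) :
      IsUnit (g.toMatrix f)ᵀ.det := by
    rw [det_transpose, ← Basis.det_apply]
    exact Basis.isUnit_det g f
  -- `ρ'` lists the rows with the two lattice blocks swapped, so that both matrices reindex one with
  -- row blocks `x`, `B`, `B'`.
  let ρ' : Fin (n + 1) ⊕ Fin r ≃ Unit ⊕ (Fin r ⊕ Fin n) :=
    (splitFirstRow n r).trans (Equiv.sumCongr (Equiv.refl _) (Equiv.sumComm _ _))
  obtain ⟨ε, hε⟩ := exists_units_det_submatrix_equiv (splitFirstRow r n) σ ρ' σ'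
  let P : Matrix (Fin r) (Fin r) ℤ := (α'.toMatrix β)ᵀ
  let Q : Matrix (Fin n) (Fin n) ℤ := (β'.toMatrix α)ᵀ
  let W : Matrix (Fin r ⊕ Fin n) (Fin r ⊕ Fin n) ℤ := fromBlocks P 0 0 Q
  let U : Matrix (Unit ⊕ (Fin r ⊕ Fin n)) (Unit ⊕ (Fin r ⊕ Fin n)) ℤ := fromBlocks 1 0 0 W
  obtain ⟨ε', hε'⟩ : IsUnit U.det := by
    rw [det_fromBlocks_zero₂₁, det_fromBlocks_zero₂₁, det_one, one_mul]
    exact (hdet _ _).mul (hdet _ _)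
  refine ⟨ε' * ε, fun x => ?_⟩
  have h1 : fromRows (of fun _ : Unit => x)
      (fromRows (of fun k => (β k).1) (of fun k => (α k).1)) =
      U * fromRows (of fun _ : Unit => x)
        (fromRows (of fun k => (α' k).1) (of fun k => (β' k).1)) := by
    rw [fromBlocks_mul_fromRows, fromBlocks_mul_fromRows, key β α', key α β']
    simp [P, Q]
  have h2 : fromRows (consRow x (of fun k => (β' k).1)) (of fun k => (α' k).1) =
      (fromRows (of fun _ : Unit => x)
        (fromRows (of fun k => (α' k).1) (of fun k => (β' k).1))).submatrix ρ' id := by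
    rw [fromRows_consRow]
    ext a e
    simp only [submatrix_apply, ρ', Equiv.trans_apply]
    rcases splitFirstRow n r a with a | a | a <;> rfl
  rw [h2, fromRows_consRow, h1, submatrix_submatrix, submatrix_submatrix,
    ← submatrix_mul_equiv _ _ _ (splitFirstRow r n), det_mul]
  simp only [Function.comp_id, Function.id_comp]
  rw [det_submatrix_equiv_self, hε, Units.val_mul, hε', mul_assoc]

/-- The combination of circuit vectors weighted by winding numbers. -/
theorem exists_sum_detAlong_mul_circuitVec {c : Type u} [Fintype c] [LinearOrder c] {r n : ℕ}
    (A : Matrix (Fin n) c ℤ) [Finite ((Fin n → ℤ) ⧸ LinearMap.range A.mulVecLin)]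
    {B Z : Submodule ℤ (c → ℤ)} (hZ : Z = LinearMap.ker A.mulVecLin) (hBZ : B ≤ Z)
    (ζ : Basis (Fin (r + 1)) ℤ Z) (β : Basis (Fin r) ℤ B)
    (C : {I : Finset c // I.card = n + 1} → Z) (hC : ∀ I, (C I).1 = circuitVec A I.1 I.2) :
    ∃ (σ : Fin (r + 1) ⊕ Fin n ≃ c) (ε : ℤˣ), ∀ e,
      ∑ I, detAlong hBZ ζ β (C I) * (C I).1 e =
        ε * (Nat.card ((Fin n → ℤ) ⧸ LinearMap.range A.mulVecLin) *
          ((fromRows (consRow (Pi.single e 1) (of fun k => (β k).1)) A).submatrix id σ).det) := by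
  subst hZ
  obtain ⟨σ, ε, hD, hε⟩ := exists_equiv_det_fromRows_ker A ζ
  refine ⟨σ, ε, fun e => mul_left_cancel₀ hD ?_⟩
  -- The weight vector represents `z ↦ det(z, β, A)`; on the circuit vectors its values are the
  -- winding numbers times the determinant being cancelled.
  have h := sum_dotProduct_circuitVec_mul_apply A _
    (mulVec_det_fromRows_consRow σ (of fun k => (β k).1) A) e
  rw [hε] at h
  rw [Finset.mul_sum]
  refine Eq.trans (Finset.sum_congr rfl fun I _ => ?_) (h.trans (by ring))
  rw [← det_fromRows_consRow, ← hC, ← detAlong_mul_det_fromRows hBZ ζ β (C I) A σ]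
  ring

end Matrix

/-! ### Coordinate matrices and their row lattices -/

section Coordinates

variable {b c : Type u} [Fintype c] {n : ℕ} {D : Matrix b c ℤ} {K : Submodule ℤ (b → ℤ)}
  (hD : ∀ e, Dᵀ e ∈ K) (η : Basis (Fin n) ℤ K)

theorem mulVec_eq_sum_smul {b c : Type*} [Fintype c] (D : Matrix b c ℤ) (x : c → ℤ) :
    D *ᵥ x = ∑ e, x e • D.col e := by
  ext f
  simp [mulVec, dotProduct, mul_comm]

theorem mulVec_mem_of_col_mem {b c : Type*} [Fintype c] {D : Matrix b c ℤ}
    {K : Submodule ℤ (b → ℤ)} (hD : ∀ e, Dᵀ e ∈ K) (x : c → ℤ) : D *ᵥ x ∈ K := by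
  rw [mulVec_eq_sum_smul]
  exact K.sum_mem fun e _ => K.smul_mem _ (hD e)

theorem coordMatrix_mulVec (x : c → ℤ) :
    coordMatrix D K hD η *ᵥ x = η.equivFun ⟨D *ᵥ x, mulVec_mem_of_col_mem hD x⟩ := by
  have h : (⟨D *ᵥ x, mulVec_mem_of_col_mem hD x⟩ : K) = ∑ e, x e • ⟨Dᵀ e, hD e⟩ := by
    refine Subtype.ext ((mulVec_eq_sum_smul D x).trans ?_)
    rw [AddSubmonoidClass.coe_finsetSum]
    rfl
  rw [h, map_sum, mulVec_eq_sum_smul]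
  refine Finset.sum_congr rfl fun e _ => ?_
  rw [map_smul]
  rfl

theorem ker_coordMatrix :
    LinearMap.ker (coordMatrix D K hD η).mulVecLin = LinearMap.ker D.mulVecLin := by
  ext x
  simp only [LinearMap.mem_ker, mulVecLin_apply]
  rw [coordMatrix_mulVec, LinearEquiv.map_eq_zero_iff, Submodule.mk_eq_zero]

/-- This identifies the cokernel of the coordinate matrix with a homology or cohomology group. -/
theorem nonempty_quotient_range_coordMatrix_equiv :
    Nonempty ((K ⧸ (LinearMap.range D.mulVecLin).submoduleOf K) ≃ₗ[ℤ]
      (Fin n → ℤ) ⧸ LinearMap.range (coordMatrix D K hD η).mulVecLin) := by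
  refine ⟨Submodule.Quotient.equiv _ _ η.equivFun ?_⟩
  ext y
  constructor
  · rintro ⟨z, ⟨x, hx⟩, rfl⟩
    refine ⟨x, ?_⟩
    rw [mulVecLin_apply, coordMatrix_mulVec]
    exact congrArg η.equivFun (Subtype.ext hx)
  · rintro ⟨x, rfl⟩
    refine ⟨⟨D *ᵥ x, mulVec_mem_of_col_mem hD x⟩, ⟨x, rfl⟩, ?_⟩
    rw [mulVecLin_apply, coordMatrix_mulVec]
    rfl

/-- The range of `f` lies in a finite free `ℤ`-module, hence is free, and the surjection onto it
splits. -/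
theorem LinearMap.exists_leftInverse_ker {M N : Type*} [AddCommGroup M] [AddCommGroup N]
    [Module.Finite ℤ N] [Module.Free ℤ N] (f : M →ₗ[ℤ] N) :
    ∃ p : M →ₗ[ℤ] LinearMap.ker f, ∀ x, p x.1 = x := by
  obtain ⟨s, hs⟩ := f.rangeRestrict.exists_rightInverse_of_surjective f.range_rangeRestrict
  have hs' (y : LinearMap.range f) : f (s y) = y.1 :=
    congrArg Subtype.val (LinearMap.congr_fun hs y)
  refine ⟨LinearMap.codRestrict _ (LinearMap.id - s ∘ₗ f.rangeRestrict) fun x => ?_, fun x => ?_⟩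
  · simp [hs']
  · have h : f.rangeRestrict x.1 = 0 := Subtype.ext x.2
    ext1
    simp [h]

/-- The order `m` of the quotient moves each unit vector into the range; pairing a row relation `v`
with `m` times the `k`-th one gives `m * v k = 0`. -/
theorem linearIndependent_of_finite_quotient_range (A : Matrix (Fin n) c ℤ)
    [Finite ((Fin n → ℤ) ⧸ LinearMap.range A.mulVecLin)] : LinearIndependent ℤ A.row := by
  refine Fintype.linearIndependent_iff.2 fun v hv k => ?_
  set m := Nat.card ((Fin n → ℤ) ⧸ LinearMap.range A.mulVecLin) with hm
  have hm0 : m ≠ 0 := Nat.card_pos.ne'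
  have h : m • Submodule.Quotient.mk (p := LinearMap.range A.mulVecLin) (Pi.single k (1 : ℤ)) = 0 :=
    card_nsmul_eq_zero'
  rw [← Submodule.Quotient.mk_smul, Submodule.Quotient.mk_eq_zero] at h
  obtain ⟨x, hx⟩ := h
  have h1 : v ⬝ᵥ (A *ᵥ x) = 0 := by
    rw [dotProduct_mulVec, vecMul_eq_sum]
    exact (congrArg (· ⬝ᵥ x) hv).trans (zero_dotProduct x)
  rw [mulVecLin_apply] at hx
  rw [hx, dotProduct_smul, dotProduct_single_one] at h1
  simpa [hm0] using h1

/-- For a saturated lattice `K`, the rows of the coordinate matrix form a basis of the row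
lattice. -/
theorem exists_basis_range_transpose {a : Type*} [Finite a] [Fintype b]
    {M : Matrix a b ℤ} (hK : K = LinearMap.ker M.mulVecLin)
    [Finite ((Fin n → ℤ) ⧸ LinearMap.range (coordMatrix D K hD η).mulVecLin)] :
    ∃ α : Basis (Fin n) ℤ (LinearMap.range Dᵀ.mulVecLin),
      (of fun k => (α k).1) = coordMatrix D K hD η := by
  classical
  obtain ⟨p, hp⟩ : ∃ p : (b → ℤ) →ₗ[ℤ] K, ∀ x : K, p x.1 = x := by
    subst hK
    exact LinearMap.exists_leftInverse_ker _
  set A := coordMatrix D K hD η with hA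
  have hmem (k : Fin n) : A k ∈ LinearMap.range Dᵀ.mulVecLin := by
    -- Saturation enters here: the projection `p` extends the `k`-th coordinate functional to all of
    -- `b → ℤ`, and the witness lists its values on unit vectors.
    refine ⟨fun f => η.repr (p (Pi.single f 1)) k, ?_⟩
    ext e
    let F : (b → ℤ) →ₗ[ℤ] ℤ := η.coord k ∘ₗ p
    have h := LinearMap.pi_apply_eq_sum_univ F (Dᵀ e)
    have h1 : F (Dᵀ e) = A k e := by
      change η.repr (p (⟨Dᵀ e, hD e⟩ : K).1) k = _
      rw [hp]
      rfl
    rw [← h1, h, mulVecLin_apply, mulVec, dotProduct]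
    refine Finset.sum_congr rfl fun f _ => ?_
    have : (fun j => if f = j then (1 : ℤ) else 0) = Pi.single f 1 := by
      ext j; simp [Pi.single_apply, eq_comm]
    rw [this]
    rfl
  let v : Fin n → LinearMap.range Dᵀ.mulVecLin := fun k => ⟨A k, hmem k⟩
  have hli : LinearIndependent ℤ v :=
    LinearIndependent.of_comp (Submodule.subtype _) (linearIndependent_of_finite_quotient_range A)
  have hsp : ⊤ ≤ Submodule.span ℤ (Set.range v) := by
    rintro ⟨_, y, rfl⟩ -
    have h : (⟨Dᵀ.mulVecLin y, y, rfl⟩ : LinearMap.range Dᵀ.mulVecLin) =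
        ∑ k, (∑ f, y f * (η k).1 f) • v k := by
      ext e
      have h1 (f : b) : D f e = ∑ k, A k e * (η k).1 f := by
        have h := congrArg (fun x : K => x.1 f) (η.sum_repr ⟨Dᵀ e, hD e⟩)
        simp only [AddSubmonoidClass.coe_finsetSum, Finset.sum_apply] at h
        exact h.symm
      simp only [mulVecLin_apply, mulVec, dotProduct, transpose_apply, h1,
        AddSubmonoidClass.coe_finsetSum, Finset.sum_apply, Submodule.coe_smul, Pi.smul_apply,
        smul_eq_mul, Finset.sum_mul, v]
      rw [Finset.sum_comm]
      refine Finset.sum_congr rfl fun k _ => Finset.sum_congr rfl fun f _ => ?_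
      ring
    rw [h]
    exact Submodule.sum_mem _ fun k _ => Submodule.smul_mem _ _ (Submodule.subset_span ⟨k, rfl⟩)
  refine ⟨Basis.mk hli hsp, ?_⟩
  ext k e
  simp [v]

end Coordinates

/-! ### Ranks of homology and cohomology -/

namespace CellComplex

variable (X : CellComplex.{u}) (i : ℤ)

theorem range_boundary_eq_boundaries :
    LinearMap.range (X.boundary (i - 1) i).mulVecLin = X.boundaries (i - 1) := by
  -- The matrix type depends on the degree, so the degree is freed before `i - 1 + 1` is replaced by
  -- `i`.
  have h (k : ℤ) (hk : k = i - 1 + 1) :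
      LinearMap.range (X.boundary (i - 1) k).mulVecLin = X.boundaries (i - 1) := by
    subst hk; rfl
  exact h i (by ring)

theorem range_coboundary_eq_coboundaries :
    LinearMap.range (X.boundary i (i + 1))ᵀ.mulVecLin = X.coboundaries (i + 1) := by
  have h (k : ℤ) (hk : k = i + 1 - 1) :
      LinearMap.range (X.boundary k (i + 1))ᵀ.mulVecLin = X.coboundaries (i + 1) := by
    subst hk; rfl
  exact h i (by ring)

theorem finrank_homology_add_finrank_boundaries :
    finrank ℤ (X.Homology i) + finrank ℤ (X.boundaries i) = finrank ℤ (X.cycles i) := by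
  rw [← Submodule.finrank_quotient_add_finrank ((X.boundaries i).submoduleOf (X.cycles i)),
    (Submodule.submoduleOfEquivOfLe (X.boundaries_le_cycles i)).finrank_eq]

theorem finrank_cohomology_add_finrank_coboundaries :
    finrank ℤ (X.Cohomology i) + finrank ℤ (X.coboundaries i) = finrank ℤ (X.cocycles i) := by
  rw [← Submodule.finrank_quotient_add_finrank ((X.coboundaries i).submoduleOf (X.cocycles i)),
    (Submodule.submoduleOfEquivOfLe (X.coboundaries_le_cocycles i)).finrank_eq]

/-- Transposes have equal rank, so by rank–nullity both sides equal the rank of `C_i` minus those of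
`B_i` and `B^i`. -/
theorem finrank_cohomology : finrank ℤ (X.Cohomology i) = finrank ℤ (X.Homology i) := by
  have h1 := X.finrank_homology_add_finrank_boundaries i
  have h2 := X.finrank_cohomology_add_finrank_coboundaries i
  have h3 := Submodule.finrank_quotient_add_finrank (X.cycles i)
  have h4 := Submodule.finrank_quotient_add_finrank (X.cocycles i)
  have h5 : finrank ℤ ((X.Cell i → ℤ) ⧸ X.cycles i) = finrank ℤ (X.coboundaries i) :=
    ((X.boundary (i - 1) i).mulVecLin.quotKerEquivRange.finrank_eq).trans
      (finrank_range_transpose _).symm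
  have h6 : finrank ℤ ((X.Cell i → ℤ) ⧸ X.cocycles i) = finrank ℤ (X.boundaries i) :=
    ((X.boundary i (i + 1))ᵀ.mulVecLin.quotKerEquivRange.finrank_eq).trans
      (finrank_range_transpose _)
  omega

end CellComplex

/-! ### Harmonic cycles and cocycles as determinants -/

/-- The combination of the circuit vectors of a coordinate matrix weighted by winding numbers,
in terms of a basis of the row lattice. -/
theorem exists_sum_detAlong_mul_circuitVec_coordMatrix {a b c : Type u} [Finite a] [Fintype b]
    [Fintype c] [LinearOrder c] {r n : ℕ} (M : Matrix a b ℤ) (D : Matrix b c ℤ)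
    {K : Submodule ℤ (b → ℤ)} (hK : K = LinearMap.ker M.mulVecLin) (hD : ∀ e, Dᵀ e ∈ K)
    (η : Basis (Fin n) ℤ K) [Finite (K ⧸ (LinearMap.range D.mulVecLin).submoduleOf K)]
    {B Z : Submodule ℤ (c → ℤ)} (hZ : Z = LinearMap.ker D.mulVecLin) (hBZ : B ≤ Z)
    (ζ : Basis (Fin (r + 1)) ℤ Z) (β : Basis (Fin r) ℤ B)
    (C : {I : Finset c // I.card = n + 1} → Z)
    (hC : ∀ I, (C I).1 = circuitVec (coordMatrix D K hD η) I.1 I.2) :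
    ∃ (α : Basis (Fin n) ℤ (LinearMap.range Dᵀ.mulVecLin))
      (σ : Fin (r + 1) ⊕ Fin n ≃ c) (ε : ℤˣ), ∀ e,
      ∑ I, detAlong hBZ ζ β (C I) * (C I).1 e =
        ε * (Nat.card (K ⧸ (LinearMap.range D.mulVecLin).submoduleOf K) *
          ((fromRows (consRow (Pi.single e 1) (of fun k => (β k).1))
            (of fun k => (α k).1)).submatrix id σ).det) := by
  obtain ⟨E⟩ := nonempty_quotient_range_coordMatrix_equiv hD η
  have := Finite.of_equiv _ E.toEquiv
  obtain ⟨α, hα⟩ := exists_basis_range_transpose hD η hK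
  obtain ⟨σ, ε, h⟩ := exists_sum_detAlong_mul_circuitVec (coordMatrix D K hD η)
    (hZ.trans (ker_coordMatrix hD η).symm) hBZ ζ β C hC
  refine ⟨α, σ, ε, fun e => ?_⟩
  rw [h, hα, Nat.card_congr E.toEquiv]

namespace CellComplex

variable (X : CellComplex.{u}) (i : ℤ)

theorem exists_stdHarmonicCycle_apply [hfin : Finite (X.Homology (i - 1))]
    (η : Basis (Fin (finrank ℤ (X.cycles (i - 1)))) ℤ (X.cycles (i - 1)))
    (ζ : Basis (Fin (finrank ℤ (X.boundaries i) + 1)) ℤ (X.cycles i))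
    (β : Basis (Fin (finrank ℤ (X.boundaries i))) ℤ (X.boundaries i)) :
    ∃ (α : Basis (Fin (finrank ℤ (X.cycles (i - 1)))) ℤ (X.coboundaries i))
      (σ : Fin (finrank ℤ (X.boundaries i) + 1) ⊕ Fin (finrank ℤ (X.cycles (i - 1))) ≃ X.Cell i)
      (ε : ℤˣ), ∀ e, (X.stdHarmonicCycle i η ζ β).1 e =
        ε * (Nat.card (X.Homology (i - 1)) *
          ((fromRows (consRow (Pi.single e 1) (of fun k => (β k).1))
            (of fun k => (α k).1)).submatrix id σ).det) := by
  have hB := X.range_boundary_eq_boundaries i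
  unfold Homology at hfin ⊢
  rw [← hB] at hfin ⊢
  obtain ⟨α, σ, ε, h⟩ := exists_sum_detAlong_mul_circuitVec_coordMatrix
    (K := X.cycles (i - 1)) (X.boundary (i - 1 - 1) (i - 1)) (X.boundary (i - 1) i) rfl (X.boundary_col_mem i) η rfl
    (X.boundaries_le_cycles i) ζ β (X.cyclePart i η) (fun _ => rfl)
  refine ⟨α, σ, ε, fun e => Eq.trans ?_ (h e)⟩
  rw [stdHarmonicCycle, AddSubmonoidClass.coe_finsetSum, Finset.sum_apply]
  rfl

theorem exists_stdHarmonicCocycle_apply [hfin : Finite (X.Cohomology (i + 1))]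
    (η : Basis (Fin (finrank ℤ (X.cocycles (i + 1)))) ℤ (X.cocycles (i + 1)))
    (ζ : Basis (Fin (finrank ℤ (X.coboundaries i) + 1)) ℤ (X.cocycles i))
    (β : Basis (Fin (finrank ℤ (X.coboundaries i))) ℤ (X.coboundaries i)) :
    ∃ (α : Basis (Fin (finrank ℤ (X.cocycles (i + 1)))) ℤ (X.boundaries i))
      (σ : Fin (finrank ℤ (X.coboundaries i) + 1) ⊕ Fin (finrank ℤ (X.cocycles (i + 1))) ≃
        X.Cell i)
      (ε : ℤˣ), ∀ e, (X.stdHarmonicCocycle i η ζ β).1 e =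
        ε * (Nat.card (X.Cohomology (i + 1)) *
          ((fromRows (consRow (Pi.single e 1) (of fun k => (β k).1))
            (of fun k => (α k).1)).submatrix id σ).det) := by
  have hB := X.range_coboundary_eq_coboundaries i
  unfold Cohomology at hfin ⊢
  -- The row lattice of `δ_i` is the range of a double transpose, which is `B_i` by definition.
  rw [← hB] at hfin ⊢
  obtain ⟨α, σ, ε, h⟩ := exists_sum_detAlong_mul_circuitVec_coordMatrix
    (K := X.cocycles (i + 1)) (X.boundary (i + 1) (i + 1 + 1))ᵀ (X.boundary i (i + 1))ᵀ rfl (X.coboundary_col_mem i) η rfl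
    (X.coboundaries_le_cocycles i) ζ β (X.cocyclePart i η) (fun _ => rfl)
  refine ⟨α, σ, ε, fun e => Eq.trans ?_ (h e)⟩
  rw [stdHarmonicCocycle, AddSubmonoidClass.coe_finsetSum, Finset.sum_apply]
  rfl

end CellComplex

/-! ### Comparison of the two determinants -/

theorem mainTheorem9 (X : CellComplex.{u}) (i : ℤ) (hX : X.Unicycle i)
    -- the choices on which the standard harmonic cycle depends, up to sign
    (η : Basis (Fin (finrank ℤ (X.cycles (i - 1)))) ℤ (X.cycles (i - 1)))
    (ζ : Basis (Fin (finrank ℤ (X.boundaries i) + 1)) ℤ (X.cycles i))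
    (β : Basis (Fin (finrank ℤ (X.boundaries i))) ℤ (X.boundaries i))
    -- the choices on which the standard harmonic cocycle depends, up to sign
    (η' : Basis (Fin (finrank ℤ (X.cocycles (i + 1)))) ℤ (X.cocycles (i + 1)))
    (ζ' : Basis (Fin (finrank ℤ (X.coboundaries i) + 1)) ℤ (X.cocycles i))
    (β' : Basis (Fin (finrank ℤ (X.coboundaries i))) ℤ (X.coboundaries i)) :
    Finite (X.Homology (i - 1)) ∧ Finite (X.Cohomology (i + 1)) ∧
    ((∀ e : X.Cell i,
        ((X.stdHarmonicCycle i η ζ β).1 e : ℚ) / (Nat.card (X.Homology (i - 1)) : ℚ) =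
          ((X.stdHarmonicCocycle i η' ζ' β').1 e : ℚ) /
            (Nat.card (X.Cohomology (i + 1)) : ℚ)) ∨
      (∀ e : X.Cell i,
        ((X.stdHarmonicCycle i η ζ β).1 e : ℚ) / (Nat.card (X.Homology (i - 1)) : ℚ) =
          -(((X.stdHarmonicCocycle i η' ζ' β').1 e : ℚ) /
            (Nat.card (X.Cohomology (i + 1)) : ℚ)))) := by
  have hfin : Finite (X.Homology (i - 1)) :=
    (Module.finrank_int_eq_zero_iff_finite _).1 hX.2.2
  have hfin' : Finite (X.Cohomology (i + 1)) :=
    (Module.finrank_int_eq_zero_iff_finite _).1 ((X.finrank_cohomology (i + 1)).trans hX.1)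
  refine ⟨hfin, hfin', ?_⟩
  obtain ⟨α, σ, ε₁, h₁⟩ := X.exists_stdHarmonicCycle_apply i η ζ β
  obtain ⟨α', σ', ε₂, h₂⟩ := X.exists_stdHarmonicCocycle_apply i η' ζ' β'
  obtain ⟨ε₃, h₃⟩ := Matrix.exists_units_det_eq_of_bases β α' α β' σ σ'
  have hm : (Nat.card (X.Homology (i - 1)) : ℚ) ≠ 0 := Nat.cast_ne_zero.2 Nat.card_pos.ne'
  have hm' : (Nat.card (X.Cohomology (i + 1)) : ℚ) ≠ 0 := Nat.cast_ne_zero.2 Nat.card_pos.ne'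
  have key (e : X.Cell i) :
      ((X.stdHarmonicCycle i η ζ β).1 e : ℚ) / (Nat.card (X.Homology (i - 1)) : ℚ) =
        ((ε₁ * ε₃ * ε₂ : ℤˣ) : ℤ) * (((X.stdHarmonicCocycle i η' ζ' β').1 e : ℚ) /
            (Nat.card (X.Cohomology (i + 1)) : ℚ)) := by
    have hε : ((ε₂ : ℤ) : ℚ) * ((ε₂ : ℤ) : ℚ) = 1 := by
      rw [← Int.cast_mul, ← Units.val_mul, Int.units_mul_self, Units.val_one, Int.cast_one]
    rw [h₁, h₂, h₃]
    generalize (submatrix (_ : Matrix _ (X.Cell i) ℤ) id σ').det = d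
    push_cast
    field_simp
    -- The sign `ε₂` occurs twice, once from `h₂` and once as its own inverse.
    linear_combination (-d : ℚ) * hε
  rcases Int.units_eq_one_or (ε₁ * ε₃ * ε₂) with h | h
  · left
    intro e
    rw [key, h]
    simp
  · right
    intro e
    rw [key, h]
    simp
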